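/- By a cubic graph we mean a finite connected $3$-regular graph without loops or multiple edges; its spectrum $\sigma(Y)\subset[-3,3]$ is the set of eigenvalues of its adjacency matrix. A closed set $K\subseteq[-3,3]$ is called planar spectral if there are arbitrarily large (equivalently, infinitely many pairwise non-isomorphic) planar cubic graphs $Y$ with $\sigma(Y)\subseteq K$, and the complement $[-3,3]\setminus K$ of a planar spectral set is called a planar gap set. A point $\xi\in[-3,3]$ is planar gapped if it has an open neighbourhood in $[-3,3]$ that is a planar gap set. **Theorem.** Every point $\xi\in[-3,3)$ is planar gapped. -/

import Mathlib

open Set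

/-- A finite graph on `V` is *cubic* if it is connected and `3`-regular
(a `SimpleGraph` has no loops or multiple edges). -/
def IsCubicGraph {V : Type*} [Fintype V] (G : SimpleGraph V) : Prop :=
  G.Connected ∧ ∀ v : V, (G.neighborSet v).ncard = 3

/-- A drawing of the graph `G` in the Euclidean plane `ℂ = ℝ²` without crossings: the vertices are
distinct points, every edge `uv` is a simple arc from the point of `u` to the point of `v`, an edge
passes through no vertex but its ends, and two different edges meet at most in the points of
common end vertices. -/
structure PlaneDrawing {V : Type*} (G : SimpleGraph V) where
  /-- the position of a vertex -/
  point : V → ℂ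
  /-- the point set of an edge -/
  arc : Sym2 V → Set ℂ
  point_injective : Function.Injective point
  isArc : ∀ u v : V, G.Adj u v →
    ∃ γ : Path (point u) (point v), Function.Injective γ ∧ range γ = arc s(u, v)
  vertex_mem_arc : ∀ e ∈ G.edgeSet, ∀ w : V, point w ∈ arc e → w ∈ e
  arc_inter_arc : ∀ e ∈ G.edgeSet, ∀ e' ∈ G.edgeSet, e ≠ e' →
    ∀ z ∈ arc e ∩ arc e', ∃ w : V, w ∈ e ∧ w ∈ e' ∧ z = point w

/-- A graph is *planar* if it can be drawn in the plane without crossings. -/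
def IsPlanarGraph {V : Type*} (G : SimpleGraph V) : Prop :=
  Nonempty (PlaneDrawing G)

open Classical in
/-- The spectrum (set of eigenvalues) of the adjacency matrix of a finite graph. -/
noncomputable def graphSpectrum {V : Type*} [Fintype V] (G : SimpleGraph V) : Set ℝ :=
  spectrum ℝ (G.adjMatrix ℝ)

/-- A closed subset `K` of `[-3, 3]` is *planar spectral* if there are arbitrarily large (finite)
planar cubic graphs whose spectrum is contained in `K`. -/
def IsPlanarSpectral (K : Set ℝ) : Prop :=
  IsClosed K ∧ K ⊆ Icc (-3) 3 ∧
    ∀ N : ℕ, ∃ n : ℕ, N ≤ n ∧ ∃ G : SimpleGraph (Fin n),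
      IsCubicGraph G ∧ IsPlanarGraph G ∧ graphSpectrum G ⊆ K

/-- A *planar gap set* is the complement in `[-3, 3]` of a planar spectral set. -/
def IsPlanarGapSet (U : Set ℝ) : Prop :=
  ∃ K : Set ℝ, IsPlanarSpectral K ∧ U = Icc (-3) 3 \ K

/-- A point is *planar gapped* if it has an open neighbourhood (relative to `[-3, 3]`) which is a
planar gap set. -/
def IsPlanarGapped (ξ : ℝ) : Prop :=
  ∃ O : Set ℝ, IsOpen O ∧ ξ ∈ O ∧ IsPlanarGapSet (O ∩ Icc (-3) 3)

/-! Every vertex of an arbitrarily large planar cubic graph is replaced by a small planar piece with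
three terminals; drawn inside a small disc around the vertex, the piece keeps the graph planar. Two
kinds of piece produce gaps.

For the triangle, an eigenvalue `c` of the new graph other than `0` and `-2` makes `f c = c ^ 2 - c
- 3` an eigenvalue of the old one. So gaps pull back along `f` (`HasGapAt.of_triangleGadget`), and
points with `|f ξ| > 3` are gapped for free.

A contracting piece excludes `ξ` from the spectrum of every graph built with it: solutions of the
eigenvalue equation would have larger square sum at the far ends of the links than at the terminals,
yet reversing the links permutes these values (`Gadget.IsContracting.notEigenvalue`). By compactness
this persists near `ξ`. Such pieces treat `0`, `-1` and `[-2, -17/10]`.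

The remaining points of `[-3, 3)` reach a gapped point under iteration of `f`, because the fixed
points `-1` and `3` of `f` are repelling (`hasGapAt`). -/

/-- A straight-line drawing of a graph without crossings. -/
structure StraightDrawing {V : Type*} (G : SimpleGraph V) where
  /-- the position of a vertex -/
  point : V → ℂ
  injective : Function.Injective point
  inter : ∀ a b c d : V, G.Adj a b → G.Adj c d → s(a, b) ≠ s(c, d) →
    ∀ z ∈ segment ℝ (point a) (point b), z ∈ segment ℝ (point c) (point d) →
      ∃ w, w ∈ s(a, b) ∧ w ∈ s(c, d) ∧ z = point w

/-- A vertex lying on a foreign edge also lies on an edge of its own, so the crossing condition for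
these two edges applies. This is where isolated vertices must be excluded. -/
theorem StraightDrawing.mem_of_point_mem_segment {V : Type*} {G : SimpleGraph V}
    (D : StraightDrawing G) (hG : ∀ v, ∃ w, G.Adj v w) {a b v : V}
    (hab : G.Adj a b) (hv : D.point v ∈ segment ℝ (D.point a) (D.point b)) : v ∈ s(a, b) := by
  by_contra hve
  obtain ⟨x, hx⟩ := hG v
  have hne : s(a, b) ≠ s(v, x) := fun h => hve (h ▸ Sym2.mem_mk_left v x)
  obtain ⟨w, h1, -, h3⟩ := D.inter a b v x hab hx hne _ hv (left_mem_segment ℝ _ _)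
  exact hve (D.injective h3 ▸ h1)

theorem StraightDrawing.isPlanarGraph {V : Type*} {G : SimpleGraph V} (D : StraightDrawing G)
    (hG : ∀ v, ∃ w, G.Adj v w) : IsPlanarGraph G := by
  -- The convex hull describes the segment in terms of the unordered pair, as `arc` requires.
  have harc : ∀ u v : V, convexHull ℝ (D.point '' {w | w ∈ s(u, v)}) =
      segment ℝ (D.point u) (D.point v) := by
    intro u v
    rw [← convexHull_pair, ← image_pair]
    congr 2
    ext w
    simp [Sym2.mem_iff]
  refine ⟨⟨D.point, fun e => convexHull ℝ (D.point '' {w | w ∈ e}), D.injective, ?_, ?_, ?_⟩⟩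
  · intro u v huv
    rw [harc]
    exact ⟨.segment _ _, Path.segment_injective_of_ne (D.injective.ne huv.ne),
      Path.range_segment _ _⟩
  · intro e
    induction e using Sym2.ind with
    | _ a b =>
      intro he w hw
      rw [harc] at hw
      exact D.mem_of_point_mem_segment hG he hw
  · intro e
    induction e using Sym2.ind with
    | _ a b =>
      intro he e'
      induction e' using Sym2.ind with
      | _ c d =>
        intro he' hne z hz
        rw [harc, harc] at hz
        exact D.inter a b c d he he' hne z hz.1 hz.2

/-! ### The eigenvalue equation. -/

open Classical in
/-- The sum of `x` over the neighbours of `v`. -/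
noncomputable def nbrSum {V : Type*} [Fintype V] (G : SimpleGraph V) (x : V → ℝ) (v : V) : ℝ :=
  ∑ w, if G.Adj v w then x w else 0

/-- The number `c` is not an eigenvalue of `G`. -/
def NotEigenvalue {V : Type*} [Fintype V] (G : SimpleGraph V) (c : ℝ) : Prop :=
  ∀ x : V → ℝ, (∀ v, nbrSum G x v = c * x v) → x = 0

theorem NotEigenvalue.notMem_graphSpectrum {V : Type*} [Fintype V] {G : SimpleGraph V} {c : ℝ}
    (h : NotEigenvalue G c) : c ∉ graphSpectrum G := by
  classical
  intro hc
  unfold graphSpectrum at hc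
  rw [← Matrix.spectrum_toLin', ← Module.End.hasEigenvalue_iff_mem_spectrum] at hc
  obtain ⟨x, hx⟩ := hc.exists_hasEigenvector
  apply hx.2
  apply h
  intro v
  have := congrFun hx.apply_eq_smul v
  rw [Matrix.toLin'_apply] at this
  simp only [Matrix.mulVec, dotProduct, SimpleGraph.adjMatrix_apply, Pi.smul_apply, smul_eq_mul,
    ite_mul, one_mul, zero_mul] at this
  rw [← this]
  unfold nbrSum
  exact Finset.sum_congr rfl fun w _ => by congr

section Enumeration

variable {V : Type*} [Fintype V] {G : SimpleGraph V}

theorem nbrSum_eq_sum (e : ∀ v, Fin 3 ≃ G.neighborSet v) (x : V → ℝ) (v : V) :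
    nbrSum G x v = ∑ i, x (e v i) := by
  classical
  unfold nbrSum
  rw [← Finset.sum_filter, (e v).sum_comp (fun u : G.neighborSet v => x u)]
  refine (Finset.sum_subtype _ (fun w => ?_) x)
  simp

theorem ncard_neighborSet_eq_nbrSum (G : SimpleGraph V) (v : V) :
    ((G.neighborSet v).ncard : ℝ) = nbrSum G 1 v := by
  classical
  unfold nbrSum
  rw [Set.ncard_eq_toFinset_card', ← Finset.sum_filter]
  simp only [Pi.one_apply, Finset.sum_const, nsmul_eq_mul, mul_one, Nat.cast_inj]
  congr 1
  ext w
  simp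

theorem IsCubicGraph.exists_enumeration (hG : IsCubicGraph G) :
    Nonempty (∀ v, Fin 3 ≃ G.neighborSet v) := by
  classical
  refine ⟨fun v => Fintype.equivOfCardEq ?_⟩
  rw [Fintype.card_fin, ← hG.2 v, ← Nat.card_coe_set_eq, Nat.card_eq_fintype_card]

theorem IsCubicGraph.exists_adj (hG : IsCubicGraph G) (v : V) : ∃ w, G.Adj v w := by
  obtain ⟨e⟩ := hG.exists_enumeration
  exact ⟨e v 0, (e v 0).2⟩

/-- Maximum principle: at a vertex where `|x|` is largest, the equation gives `|c| * |x v| ≤ 3 * |x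
v|`. -/
theorem IsCubicGraph.notEigenvalue (hG : IsCubicGraph G) {c : ℝ} (hc : 3 < |c|) :
    NotEigenvalue G c := by
  intro x hx
  obtain ⟨e⟩ := hG.exists_enumeration
  have := hG.1.nonempty
  obtain ⟨v, -, hv⟩ := Finset.exists_max_image Finset.univ (fun v => |x v|) Finset.univ_nonempty
  have h0 : |c| * |x v| ≤ 3 * |x v| := by
    rw [← abs_mul, ← hx v, nbrSum_eq_sum e, Fin.sum_univ_three]
    have h1 := hv (e v 0) (Finset.mem_univ _)
    have h2 := hv (e v 1) (Finset.mem_univ _)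
    have h3 := hv (e v 2) (Finset.mem_univ _)
    have := abs_add_three (x (e v 0)) (x (e v 1)) (x (e v 2))
    linarith
  have h1 : |x v| = 0 := by
    have := abs_nonneg (x v)
    nlinarith
  funext w
  have := hv w (Finset.mem_univ _)
  rw [h1] at this
  exact abs_eq_zero.1 (le_antisymm this (abs_nonneg _))

end Enumeration

/-! ### Gaps and their transport to graphs on `Fin n`. -/

/-- Around `ξ` there is an open interval which contains no eigenvalue of suitable arbitrarily large
cubic graphs with a straight-line drawing. -/
def HasGapAt (ξ : ℝ) : Prop :=
  ∃ ε > 0, ∀ N : ℕ, ∃ (V : Type) (_ : Fintype V) (G : SimpleGraph V), N ≤ Fintype.card V ∧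
    IsCubicGraph G ∧ Nonempty (StraightDrawing G) ∧ ∀ c : ℝ, |c - ξ| < ε → NotEigenvalue G c

theorem HasGapAt.isPlanarGapped {ξ : ℝ} (hξ : HasGapAt ξ) : IsPlanarGapped ξ := by
  classical
  obtain ⟨ε, hε, h⟩ := hξ
  refine ⟨Metric.ball ξ ε, Metric.isOpen_ball, Metric.mem_ball_self hε,
    Icc (-3) 3 \ Metric.ball ξ ε, ⟨isClosed_Icc.sdiff Metric.isOpen_ball, sdiff_subset, ?_⟩, ?_⟩
  · intro N
    obtain ⟨V, _, G, hN, hG, ⟨D⟩, hc⟩ := h N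
    let f : Fin (Fintype.card V) ≃ V := (Fintype.equivFin V).symm
    let F : G.comap f ≃g G := SimpleGraph.Iso.comap f G
    have hnc : ∀ v, ((G.comap f).neighborSet v).ncard = 3 := by
      intro v
      rw [← hG.2 (f v), ← Set.ncard_image_of_injective _ f.injective]
      congr 1
      ext w
      constructor
      · rintro ⟨u, hu, rfl⟩
        exact hu
      · intro hw
        exact ⟨f.symm w, by simpa using hw, by simp⟩
    have hG' : IsCubicGraph (G.comap f) := ⟨F.connected_iff.2 hG.1, hnc⟩
    have D' : StraightDrawing (G.comap f) :=
      { point := fun v => D.point (f v)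
        injective := D.injective.comp f.injective
        inter := by
          intro a b c d hab hcd hne z hz hz'
          obtain ⟨w, h1, h2, h3⟩ := D.inter (f a) (f b) (f c) (f d) hab hcd
            (fun h => hne (Sym2.map.injective f.injective (by simpa using h))) z hz hz'
          refine ⟨f.symm w, ?_, ?_, by simpa using h3⟩
          · simpa [Sym2.mem_iff, Equiv.symm_apply_eq] using h1
          · simpa [Sym2.mem_iff, Equiv.symm_apply_eq] using h2 }
    have hnot : ∀ c, NotEigenvalue G c → NotEigenvalue (G.comap f) c := by
      intro c hc x hx
      have := hc (fun v => x (f.symm v)) (by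
        intro v
        rw [← hx (f.symm v)]
        unfold nbrSum
        rw [← f.sum_comp]
        simp)
      funext v
      simpa using congrFun this (f v)
    refine ⟨_, hN, G.comap f, hG', D'.isPlanarGraph hG'.exists_adj, ?_⟩
    intro c hcs
    by_contra hcn
    refine NotEigenvalue.notMem_graphSpectrum (hnot c ?_) hcs
    by_cases h3 : 3 < |c|
    · exact hG.notEigenvalue h3
    · apply hc
      by_contra hcb
      exact hcn ⟨abs_le.1 (not_lt.1 h3), hcb⟩
  · ext z
    simp only [mem_inter_iff, mem_sdiff]
    tauto

/-! ### Gadgets with decidable certificates. -/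

/-- The edges `ab` and `cd` are equal, or they share a vertex and are not parallel, or the line
through one of them has the other edge strictly on one side. -/
abbrev EdgesCompatible {α : Type*} (px py : α → ℤ) (a b c d : α) : Prop :=
  (a = c ∧ b = d) ∨ (a = d ∧ b = c) ∨
  ((a = c ∨ a = d ∨ b = c ∨ b = d) ∧
    ((px b - px a) * (py d - py c) - (py b - py a) * (px d - px c) ≠ 0)) ∨
  0 < ((px b - px a) * (py c - py a) - (py b - py a) * (px c - px a)) *
      ((px b - px a) * (py d - py a) - (py b - py a) * (px d - px a)) ∨
  0 < ((px d - px c) * (py a - py c) - (py d - py c) * (px a - px c)) *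
      ((px d - px c) * (py b - py c) - (py d - py c) * (px b - px c))

/-- A planar piece which can replace the vertices of a cubic graph: a graph on `Fin m` with three
terminals, which becomes cubic when one more edge is attached to every terminal, together with a
straight-line drawing with integral coordinates inside the triangle `0 ≤ x`, `0 ≤ y`,
`x + y ≤ size`, whose corners are the terminals. -/
structure Gadget (m : ℕ) where
  adj : Fin m → Fin m → Bool
  symm : ∀ a b, adj a b = adj b a
  loopless : ∀ a, adj a a = false
  terminal : Fin 3 → Fin m
  terminal_injective : Function.Injective terminal
  degree : ∀ a, (∑ b, if adj a b then 1 else 0) + (∑ i, if terminal i = a then 1 else 0) = 3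
  descends : ∀ a : Fin m, (a : ℕ) ≠ 0 → ∃ b, b < a ∧ adj a b
  size : ℤ
  size_pos : 0 < size
  px : Fin m → ℤ
  py : Fin m → ℤ
  px_terminal : ∀ i, px (terminal i) = if i = 1 then size else 0
  py_terminal : ∀ i, py (terminal i) = if i = 2 then size else 0
  px_nonneg : ∀ a, 0 ≤ px a
  py_nonneg : ∀ a, 0 ≤ py a
  px_add_py_le : ∀ a, px a + py a ≤ size
  pos_injective : ∀ a b, px a = px b → py a = py b → a = b
  inter : ∀ a b, adj a b → ∀ c d, adj c d → EdgesCompatible px py a b c d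

/-! ### Replacing vertices by gadgets. -/

section Replace

variable {V : Type} {G : SimpleGraph V} (e : ∀ v, Fin 3 ≃ G.neighborSet v)

/-- Reversal of the directed edges `(v, i)`, the `i`-th edge starting in `v`. -/
def dartRev (d : V × Fin 3) : V × Fin 3 :=
  (e d.1 d.2, (e (e d.1 d.2)).symm ⟨d.1, (e d.1 d.2).2.symm⟩)

variable {e}

theorem dartRev_eq_iff {v u : V} {i j : Fin 3} :
    dartRev e (v, i) = (u, j) ↔ (e v i : V) = u ∧ (e u j : V) = v := by
  unfold dartRev
  constructor
  · intro h
    obtain ⟨h1, h2⟩ := Prod.mk.inj h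
    subst h1
    refine ⟨rfl, ?_⟩
    rw [← h2]
    simp
  · rintro ⟨rfl, h⟩
    refine Prod.ext rfl ?_
    simp only
    rw [Equiv.symm_apply_eq]
    exact Subtype.ext h.symm

theorem dartRev_dartRev (d : V × Fin 3) : dartRev e (dartRev e d) = d := by
  obtain ⟨v, i⟩ := d
  obtain ⟨⟨u, j⟩, h⟩ : ∃ q, dartRev e (v, i) = q := ⟨_, rfl⟩
  rw [h, dartRev_eq_iff]
  exact (dartRev_eq_iff.1 h).symm

theorem dartRev_fst_adj (d : V × Fin 3) : G.Adj d.1 (dartRev e d).1 := (e d.1 d.2).2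

variable (e) {m : ℕ} (H : Gadget m)

/-- The end of the edge leaving the gadget at `d.1` through its terminal `d.2`. -/
def linkEnd (d : V × Fin 3) : V × Fin m := ((dartRev e d).1, H.terminal (dartRev e d).2)

/-- The graph in which every vertex of the cubic graph `G` is replaced by the gadget `H`. -/
def replaceVertices : SimpleGraph (V × Fin m) where
  Adj p q := (p.1 = q.1 ∧ H.adj p.2 q.2) ∨ ∃ i, H.terminal i = p.2 ∧ q = linkEnd e H (p.1, i)
  symm := ⟨by
    rintro ⟨v, w⟩ ⟨v', w'⟩ (⟨h1, h2⟩ | ⟨i, h1, h2⟩)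
    · exact Or.inl ⟨h1.symm, by rw [H.symm]; exact h2⟩
    · obtain ⟨⟨u, j⟩, h⟩ : ∃ q, dartRev e (v, i) = q := ⟨_, rfl⟩
      simp only [linkEnd, h] at h2
      obtain ⟨rfl, rfl⟩ := Prod.mk.inj h2
      refine Or.inr ⟨j, rfl, ?_⟩
      simp only [linkEnd]
      rw [← h, dartRev_dartRev, h1]⟩
  loopless := ⟨by
    rintro ⟨v, w⟩ (⟨-, h2⟩ | ⟨i, -, h2⟩)
    · simp only [H.loopless] at h2
      exact absurd h2 (by simp)
    · exact (dartRev_fst_adj (e := e) (v, i)).ne (congrArg (Prod.fst : V × Fin m → V) h2)⟩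

variable [Fintype V]

theorem nbrSum_replaceVertices (x : V × Fin m → ℝ) (v : V) (a : Fin m) :
    nbrSum (replaceVertices e H) x (v, a) =
      (∑ b, if H.adj a b then x (v, b) else 0) +
        ∑ i, if H.terminal i = a then x (linkEnd e H (v, i)) else 0 := by
  classical
  have h1 : (∑ b, if H.adj a b then x (v, b) else 0) =
      ∑ q : V × Fin m, if v = q.1 ∧ H.adj a q.2 then x q else 0 := by
    rw [Fintype.sum_prod_type, Finset.sum_eq_single v]
    · simp
    · intro u _ hu
      simp [hu.symm]
    · simp
  have h2 : (∑ i, if H.terminal i = a then x (linkEnd e H (v, i)) else 0) =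
      ∑ q : V × Fin m, if ∃ i, H.terminal i = a ∧ q = linkEnd e H (v, i) then x q else 0 := by
    by_cases ha : ∃ i, H.terminal i = a
    · obtain ⟨i, rfl⟩ := ha
      simp [H.terminal_injective.eq_iff]
    · push Not at ha
      simp [ha]
  rw [h1, h2, ← Finset.sum_add_distrib]
  refine Finset.sum_congr rfl fun q _ => ?_
  by_cases hA : v = q.1 ∧ H.adj a q.2
  · have hB : ¬ ∃ i, H.terminal i = a ∧ q = linkEnd e H (v, i) := by
      rintro ⟨i, -, rfl⟩
      exact (dartRev_fst_adj (e := e) (v, i)).ne hA.1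
    rw [if_pos (show (replaceVertices e H).Adj (v, a) q from Or.inl hA), if_pos hA, if_neg hB,
      add_zero]
  · rw [if_neg hA, zero_add]
    by_cases hB : ∃ i, H.terminal i = a ∧ q = linkEnd e H (v, i)
    · rw [if_pos (show (replaceVertices e H).Adj (v, a) q from Or.inr hB), if_pos hB]
    · rw [if_neg (show ¬ (replaceVertices e H).Adj (v, a) q from not_or.2 ⟨hA, hB⟩), if_neg hB]

/-- By `descends`, every vertex is joined to vertex `0` by a path of decreasing labels. -/
theorem Gadget.reachable {H : Gadget m} {W : Type*} {K : SimpleGraph W} (f : Fin m → W)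
    (hf : ∀ a b, H.adj a b → K.Adj (f a) (f b)) (a b : Fin m) : K.Reachable (f a) (f b) := by
  have key : ∀ n (a : Fin m) (h0 : 0 < m), (a : ℕ) = n → K.Reachable (f a) (f ⟨0, h0⟩) := by
    intro n
    induction n using Nat.strong_induction_on with
    | _ n ih =>
      intro a h0 ha
      by_cases hz : (a : ℕ) = 0
      · rw [show a = ⟨0, h0⟩ from Fin.ext hz]
      · obtain ⟨b, hb, hab⟩ := H.descends a hz
        exact (hf a b hab).reachable.trans (ih b (ha ▸ hb) b h0 rfl)
  have h0 : 0 < m := a.pos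
  exact (key _ a h0 rfl).trans (key _ b h0 rfl).symm

theorem isCubicGraph_replaceVertices (hG : G.Connected) :
    IsCubicGraph (replaceVertices e H) := by
  classical
  have hin : ∀ v a b, (replaceVertices e H).Reachable (v, a) (v, b) := fun v =>
    Gadget.reachable (H := H) (fun a => (v, a)) fun a b h => Or.inl ⟨rfl, h⟩
  have hadj : ∀ u v, G.Adj u v → ∃ a b, (replaceVertices e H).Reachable (u, a) (v, b) := by
    intro u v huv
    obtain ⟨i, hi⟩ := (e u).surjective ⟨v, huv⟩
    refine ⟨H.terminal i, (linkEnd e H (u, i)).2, SimpleGraph.Adj.reachable (Or.inr ⟨i, rfl, ?_⟩)⟩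
    refine Prod.ext ?_ rfl
    simp [linkEnd, dartRev, hi]
  have hall : ∀ u v, G.Reachable u v → ∀ a b, (replaceVertices e H).Reachable (u, a) (v, b) := by
    rintro u v ⟨p⟩
    induction p with
    | nil => exact hin _
    | cons h _ ih =>
      intro a b
      obtain ⟨a', b', hab⟩ := hadj _ _ h
      exact ((hin _ a a').trans hab).trans (ih b' b)
  have := hG.nonempty
  have : Nonempty (Fin m) := ⟨H.terminal 0⟩
  refine ⟨⟨fun p q => hall p.1 q.1 (hG p.1 q.1) p.2 q.2⟩, ?_⟩
  rintro ⟨v, a⟩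
  have h1 := ncard_neighborSet_eq_nbrSum (replaceVertices e H) (v, a)
  rw [nbrSum_replaceVertices] at h1
  have h2 := H.degree a
  simp only [Pi.one_apply] at h1
  have h3 := congrArg (Nat.cast (R := ℝ)) h2
  push_cast at h3
  exact_mod_cast h1.trans h3

end Replace

/-! ### Contracting gadgets. -/

section Spectrum

variable {m : ℕ} (H : Gadget m)

/-- The sum over the neighbours inside a gadget. -/
def Gadget.innerSum (x : Fin m → ℝ) (a : Fin m) : ℝ := ∑ b, if H.adj a b then x b else 0

/-- At every nonzero solution of the eigenvalue equation for `c` in the inner vertices of the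
gadget, the values at the terminals have smaller norm than the values which the eigenvalue equation
forces upon the outer neighbours of the terminals. -/
def Gadget.IsContracting (c : ℝ) : Prop :=
  ∀ x : Fin m → ℝ, (∀ a, (∀ i, H.terminal i ≠ a) → H.innerSum x a = c * x a) → x ≠ 0 →
    ∑ i, x (H.terminal i) ^ 2 <
      ∑ i, (c * x (H.terminal i) - H.innerSum x (H.terminal i)) ^ 2

variable {H}

theorem Gadget.innerSum_smul (r : ℝ) (x : Fin m → ℝ) (a : Fin m) :
    H.innerSum (r • x) a = r * H.innerSum x a := by
  simp [Gadget.innerSum, Finset.mul_sum]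

theorem Gadget.continuous_innerSum (a : Fin m) : Continuous fun x => H.innerSum x a := by
  unfold Gadget.innerSum
  refine continuous_finsetSum _ fun b _ => ?_
  split_ifs <;> fun_prop

/-- By homogeneity it suffices to consider `x` on the unit sphere. The counterexamples `(c, x)` with
`c` near `ξ` then form a compact set `K`, whose projection to `c` is closed and misses `ξ`. -/
theorem Gadget.IsContracting.eventually {ξ : ℝ} (h : H.IsContracting ξ) :
    ∃ ε > 0, ∀ c, |c - ξ| < ε → H.IsContracting c := by
  have hcont := H.continuous_innerSum
  let K : Set (ℝ × (Fin m → ℝ)) := (Icc (ξ - 1) (ξ + 1) ×ˢ Metric.sphere 0 1) ∩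
    ({p | ∀ a, (∀ i, H.terminal i ≠ a) → H.innerSum p.2 a = p.1 * p.2 a} ∩
      {p | ∑ i, (p.1 * p.2 (H.terminal i) - H.innerSum p.2 (H.terminal i)) ^ 2 ≤
        ∑ i, p.2 (H.terminal i) ^ 2})
  have hK : IsCompact K := by
    refine (isCompact_Icc.prod (isCompact_sphere _ _)).inter_right (IsClosed.inter ?_ ?_)
    · simp only [ofPred_forall]
      refine isClosed_iInter fun a => isClosed_iInter fun _ => isClosed_eq ?_ ?_
      · exact (hcont a).comp continuous_snd
      · fun_prop
    · refine isClosed_le ?_ (by fun_prop)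
      refine continuous_finsetSum _ fun i _ => ?_
      have := (hcont (H.terminal i)).comp (continuous_snd (X := ℝ))
      simp only [Function.comp_def] at this
      fun_prop
  have hξ : ξ ∉ Prod.fst '' K := by
    rintro ⟨⟨c, x⟩, ⟨⟨-, h1⟩, h2, h3⟩, rfl⟩
    have hx : x ≠ 0 := by
      rintro rfl
      simp at h1
    exact absurd (h x h2 hx) (not_lt.2 h3)
  obtain ⟨δ, hδ, hball⟩ := Metric.isOpen_iff.1 (hK.image continuous_fst).isClosed.isOpen_compl ξ hξ
  refine ⟨min δ 1, lt_min hδ one_pos, fun c hc x hx hx0 => ?_⟩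
  by_contra hcon
  refine hball (Metric.mem_ball.2 (hc.trans_le (min_le_left _ _))) ⟨(c, ‖x‖⁻¹ • x), ?_, rfl⟩
  have h1 := abs_lt.1 (hc.trans_le (min_le_right _ _))
  refine ⟨⟨⟨by linarith, by linarith⟩, ?_⟩, ?_, ?_⟩
  · simp [norm_smul, inv_mul_cancel₀ (norm_ne_zero_iff.2 hx0)]
  · intro a ha
    simp only [Gadget.innerSum_smul, hx a ha, Pi.smul_apply, smul_eq_mul]
    ring
  · have hs : ∀ i, (c * (‖x‖⁻¹ * x (H.terminal i)) - ‖x‖⁻¹ * H.innerSum x (H.terminal i)) ^ 2 =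
        ‖x‖⁻¹ ^ 2 * (c * x (H.terminal i) - H.innerSum x (H.terminal i)) ^ 2 := fun i => by ring
    simp only [mem_ofPred_eq, Gadget.innerSum_smul, Pi.smul_apply, smul_eq_mul, hs, mul_pow,
      ← Finset.mul_sum]
    exact mul_le_mul_of_nonneg_left (not_lt.1 hcon) (by positivity)

variable {V : Type} [Fintype V] {G : SimpleGraph V} (e : ∀ v, Fin 3 ≃ G.neighborSet v)

/-- The value forced outside a terminal is the value at the terminal across the link. As `dartRev`
is an involution, both square sums agree over the whole graph, while contraction makes one of them
strictly larger. -/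
theorem Gadget.IsContracting.notEigenvalue {c : ℝ} (h : H.IsContracting c) :
    NotEigenvalue (replaceVertices e H) c := by
  intro x hx
  have hinner : ∀ v a, (∀ i, H.terminal i ≠ a) →
      H.innerSum (fun b => x (v, b)) a = c * x (v, a) := by
    intro v a ha
    rw [← hx, nbrSum_replaceVertices]
    simp [ha, Gadget.innerSum]
  have houter : ∀ v i, c * x (v, H.terminal i) -
      H.innerSum (fun b => x (v, b)) (H.terminal i) = x (linkEnd e H (v, i)) := by
    intro v i
    rw [← hx, nbrSum_replaceVertices]
    simp [Gadget.innerSum, H.terminal_injective.eq_iff]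
  have hsum : ∑ v, ∑ i, x (linkEnd e H (v, i)) ^ 2 = ∑ v, ∑ i, x (v, H.terminal i) ^ 2 := by
    have key := (Equiv.sum_comp (Function.Involutive.toPerm (dartRev e) dartRev_dartRev)
      fun d : V × Fin 3 => x (d.1, H.terminal d.2) ^ 2)
    rw [Fintype.sum_prod_type, Fintype.sum_prod_type] at key
    exact key
  by_contra hne
  obtain ⟨⟨v, a⟩, hva⟩ := Function.ne_iff.1 hne
  refine absurd hsum (ne_of_gt (Finset.sum_lt_sum (fun u _ => ?_) ⟨v, Finset.mem_univ _, ?_⟩))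
  · by_cases hu : (fun b => x (u, b)) = 0
    · have : ∀ b, x (u, b) = 0 := fun b => congrFun hu b
      simp only [this]
      simpa using Finset.sum_nonneg fun i _ => sq_nonneg (x (linkEnd e H (u, i)))
    · simpa only [houter] using (h _ (hinner u) hu).le
  · simpa only [houter] using h _ (hinner v) fun h0 => hva (congrFun h0 a)

end Spectrum

/-! ### The triangle and the map `c ^ 2 - c - 3`. -/

/-- The triangle all whose vertices are terminals. -/
def triangleGadget : Gadget 3 where
  adj a b := decide (a ≠ b)
  symm := by decide
  loopless := by decide
  terminal := id
  terminal_injective := Function.injective_id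
  degree := by decide
  descends := by decide
  size := 1
  size_pos := by decide
  px := ![0, 1, 0]
  py := ![0, 0, 1]
  px_terminal := by decide
  py_terminal := by decide
  px_nonneg := by decide
  py_nonneg := by decide
  px_add_py_le := by decide
  pos_injective := by decide
  inter := by decide

/-- With `F` the sum over each triangle, eliminating the value across a link expresses `(c ^ 2 + 2 *
c) * x d` through `F` at both ends of `d`. Summing over a triangle shows that `F` solves the
equation of `G` for `c ^ 2 - c - 3`; so `F = 0`, and then `x = 0` since `c ^ 2 + 2 * c ≠ 0`. -/
theorem NotEigenvalue.replaceVertices_triangleGadget {V : Type} [Fintype V] {G : SimpleGraph V}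
    (e : ∀ v, Fin 3 ≃ G.neighborSet v) {c : ℝ} (h0 : c ≠ 0) (h2 : c ≠ -2)
    (h : NotEigenvalue G (c ^ 2 - c - 3)) :
    NotEigenvalue (replaceVertices e triangleGadget) c := by
  intro x hx
  set F : V → ℝ := fun v => ∑ i, x (v, i) with hF
  have h1 : ∀ d, (c + 1) * x d - x (dartRev e d) = F d.1 := by
    rintro ⟨v, a⟩
    have h3 : nbrSum (replaceVertices e triangleGadget) x (v, a) =
        F v - x (v, a) + x (dartRev e (v, a)) := by
      rw [nbrSum_replaceVertices]
      congr 1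
      · fin_cases a <;> simp [triangleGadget, Fin.sum_univ_three, hF] <;> ring
      · simp [triangleGadget, linkEnd]
    rw [hx] at h3
    linarith
  have h3 : ∀ d, (c ^ 2 + 2 * c) * x d = (c + 1) * F d.1 + F (dartRev e d).1 := by
    intro d
    have h4 := h1 d
    have h5 := h1 (dartRev e d)
    rw [dartRev_dartRev] at h5
    linear_combination (c + 1) * h4 + h5
  have hF0 : F = 0 := by
    apply h
    intro v
    rw [nbrSum_eq_sum e, Fin.sum_univ_three]
    have h4 : F v = x (v, 0) + x (v, 1) + x (v, 2) := Fin.sum_univ_three _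
    have h5 := h3 (v, 0)
    have h6 := h3 (v, 1)
    have h7 := h3 (v, 2)
    simp only [dartRev] at h5 h6 h7
    linear_combination -(c ^ 2 + 2 * c) * h4 - h5 - h6 - h7
  have hc : c ^ 2 + 2 * c ≠ 0 := by
    rw [show c ^ 2 + 2 * c = c * (c - -2) by ring]
    exact mul_ne_zero h0 (sub_ne_zero.2 h2)
  funext d
  have h4 := h3 d
  rw [hF0] at h4
  simpa [hc] using h4

/-! ### Triangles inscribed in small circles. -/

section Triangle

/-- The affine map from the standard triangle of size `N` to the triangle with corners
`p + ε • u i`. -/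
noncomputable def cornerMap (p : ℂ) (ε N : ℝ) (u : Fin 3 → ℂ) (X Y : ℝ) : ℂ :=
  p + ε • (u 0 + (X / N) • (u 1 - u 0) + (Y / N) • (u 2 - u 0))

theorem norm_eq_one_iff_re_im {z : ℂ} : ‖z‖ = 1 ↔ z.re * z.re + z.im * z.im = 1 := by
  rw [← Complex.normSq_apply, Complex.normSq_eq_norm_sq,
    pow_eq_one_iff_of_nonneg (norm_nonneg z) two_ne_zero]

/-- Three different points of the unit circle are not collinear. -/
theorem cross_ne_zero_of_norm_eq_one {u : Fin 3 → ℂ} (hu : ∀ i, ‖u i‖ = 1)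
    (hinj : Function.Injective u) :
    (u 1 - u 0).re * (u 2 - u 0).im - (u 1 - u 0).im * (u 2 - u 0).re ≠ 0 := by
  intro h
  have h0 := norm_eq_one_iff_re_im.1 (hu 0)
  have h1 := norm_eq_one_iff_re_im.1 (hu 1)
  have h2 := norm_eq_one_iff_re_im.1 (hu 2)
  obtain ⟨a, ha⟩ : ∃ a, a = u 1 - u 0 := ⟨_, rfl⟩
  obtain ⟨b, hb⟩ : ∃ b, b = u 2 - u 0 := ⟨_, rfl⟩
  rw [← ha, ← hb] at h
  rw [← sub_add_cancel (u 1) (u 0), ← ha] at h1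
  rw [← sub_add_cancel (u 2) (u 0), ← hb] at h2
  simp only [Complex.add_re, Complex.add_im] at h1 h2
  have hpos : ∀ c : ℂ, c ≠ 0 → c.re ^ 2 + c.im ^ 2 ≠ 0 := by
    intro c hc h
    exact hc (Complex.ext (by simp; nlinarith) (by simp; nlinarith))
  have ha0 : a ≠ 0 := ha ▸ sub_ne_zero.2 (hinj.ne (by decide))
  have hb0 : b ≠ 0 := hb ▸ sub_ne_zero.2 (hinj.ne (by decide))
  have hab : a - b ≠ 0 := by
    rw [ha, hb, sub_sub_sub_cancel_right]
    exact sub_ne_zero.2 (hinj.ne (by decide))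
  -- If `a` and `b` were parallel, both squared lengths would equal the inner product of `a` and
  -- `b`, so that `a - b = 0`.
  have e1 : a.re ^ 2 + a.im ^ 2 = a.re * b.re + a.im * b.im := by
    apply mul_left_cancel₀ (hpos b hb0)
    linear_combination (b.re ^ 2 + b.im ^ 2) * (h1 - h0) - (a.re * b.re + a.im * b.im) * (h2 - h0)
      - 2 * ((u 0).re * b.im - (u 0).im * b.re) * h
  have e2 : b.re ^ 2 + b.im ^ 2 = a.re * b.re + a.im * b.im := by
    apply mul_left_cancel₀ (hpos a ha0)
    linear_combination (a.re ^ 2 + a.im ^ 2) * (h2 - h0) - (a.re * b.re + a.im * b.im) * (h1 - h0)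
      + 2 * ((u 0).re * a.im - (u 0).im * a.re) * h
  apply hpos _ hab
  simp only [Complex.sub_re, Complex.sub_im]
  linear_combination e1 + e2

variable {p : ℂ} {ε N : ℝ} {u : Fin 3 → ℂ}

theorem cornerMap_injective (hε : ε ≠ 0) (hN : N ≠ 0) (hu : ∀ i, ‖u i‖ = 1)
    (hinj : Function.Injective u) {X Y X' Y' : ℝ}
    (h : cornerMap p ε N u X Y = cornerMap p ε N u X' Y') : X = X' ∧ Y = Y' := by
  have hc := cross_ne_zero_of_norm_eq_one hu hinj
  unfold cornerMap at h
  have h := smul_right_injective ℂ hε (add_left_cancel h)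
  have hr := congrArg Complex.re h
  have hi := congrArg Complex.im h
  simp only [Complex.add_re, Complex.add_im, Complex.real_smul, Complex.re_ofReal_mul,
    Complex.im_ofReal_mul] at hr hi
  have e1 : X / N = X' / N := by
    apply mul_right_cancel₀ hc
    linear_combination (u 2 - u 0).im * hr - (u 2 - u 0).re * hi
  have e2 : Y / N = Y' / N := by
    apply mul_right_cancel₀ hc
    linear_combination (u 1 - u 0).re * hi - (u 1 - u 0).im * hr
  exact ⟨(div_left_inj' hN).1 e1, (div_left_inj' hN).1 e2⟩

theorem exists_of_mem_segment_cornerMap {X Y X' Y' : ℝ} {z : ℂ}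
    (h : z ∈ segment ℝ (cornerMap p ε N u X Y) (cornerMap p ε N u X' Y')) :
    ∃ r : ℝ, 0 ≤ r ∧ r ≤ 1 ∧
      z = cornerMap p ε N u ((1 - r) * X + r * X') ((1 - r) * Y + r * Y') := by
  rw [segment_eq_image] at h
  obtain ⟨r, ⟨h0, h1⟩, rfl⟩ := h
  refine ⟨r, h0, h1, ?_⟩
  unfold cornerMap
  simp only [Complex.real_smul]
  push_cast
  ring

/-- The variance formula for weights `1 - a - b`, `a`, `b` at three unit vectors. For nonnegative
weights it places the triangle in the disc. -/
theorem one_sub_normSq_eq {a b : ℝ} (hu : ∀ i, ‖u i‖ = 1) :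
    1 - Complex.normSq (u 0 + a • (u 1 - u 0) + b • (u 2 - u 0)) =
      (1 - a - b) * a * Complex.normSq (u 1 - u 0) +
      (1 - a - b) * b * Complex.normSq (u 2 - u 0) + a * b * Complex.normSq (u 2 - u 1) := by
  have h0 := norm_eq_one_iff_re_im.1 (hu 0)
  have h1 := norm_eq_one_iff_re_im.1 (hu 1)
  have h2 := norm_eq_one_iff_re_im.1 (hu 2)
  simp only [Complex.normSq_apply, Complex.add_re, Complex.add_im, Complex.sub_re, Complex.sub_im,
    Complex.real_smul, Complex.re_ofReal_mul, Complex.im_ofReal_mul]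
  linear_combination -(1 - a - b) * h0 - a * h1 - b * h2

theorem norm_cornerMap_sub (hε : 0 < ε) (X Y : ℝ) : ‖cornerMap p ε N u X Y - p‖ =
    ε * ‖u 0 + (X / N) • (u 1 - u 0) + (Y / N) • (u 2 - u 0)‖ := by
  simp only [cornerMap, add_sub_cancel_left, norm_smul, Real.norm_eq_abs, abs_of_pos hε]

theorem norm_cornerMap_sub_le (hε : 0 < ε) (hN : 0 < N) (hu : ∀ i, ‖u i‖ = 1) {X Y : ℝ}
    (hX : 0 ≤ X) (hY : 0 ≤ Y) (hXY : X + Y ≤ N) : ‖cornerMap p ε N u X Y - p‖ ≤ ε := by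
  rw [norm_cornerMap_sub hε]
  apply mul_le_of_le_one_right hε.le
  have h := one_sub_normSq_eq (a := X / N) (b := Y / N) hu
  have h3 : X / N + Y / N ≤ 1 := by rw [← add_div, div_le_one hN]; exact hXY
  have h1 : 0 ≤ X / N := by positivity
  have h2 : 0 ≤ Y / N := by positivity
  have h4 : 0 ≤ 1 - X / N - Y / N := by linarith
  rw [← sq_le_one_iff₀ (norm_nonneg _), ← Complex.normSq_eq_norm_sq, ← sub_nonneg, h]
  have := Complex.normSq_nonneg (u 1 - u 0)
  have := Complex.normSq_nonneg (u 2 - u 0)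
  have := Complex.normSq_nonneg (u 2 - u 1)
  positivity

theorem cornerMap_corner (hN : N ≠ 0) (i : Fin 3) :
    cornerMap p ε N u (if i = 1 then N else 0) (if i = 2 then N else 0) = p + ε • u i := by
  unfold cornerMap
  fin_cases i <;> simp [hN]

end Triangle

/-! ### Crossings inside a gadget. -/

section GadgetDrawing

variable {m : ℕ} (H : Gadget m)

theorem eq_zero_of_mul_eq_mul {r s x y x' y' : ℝ} (hx : r * x = s * x') (hy : r * y = s * y')
    (h : x * y' - y * x' ≠ 0) : r = 0 := by
  apply (mul_eq_zero.1 _).resolve_right h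
  linear_combination y' * hx - x' * hy

theorem convexCombination_ne_zero {s c d : ℝ} (h0 : 0 ≤ s) (h1 : s ≤ 1) (h : 0 < c * d) :
    (1 - s) * c + s * d ≠ 0 := by
  intro h2
  have h3 : (1 - s) * c ^ 2 + s * (c * d) = 0 := by linear_combination c * h2
  have hc : 0 < c ^ 2 := by
    have : c ≠ 0 := left_ne_zero_of_mul h.ne'
    positivity
  rcases h1.lt_or_eq with h1 | rfl
  · have : 0 < (1 - s) * c ^ 2 := mul_pos (by linarith) hc
    have := mul_nonneg h0 h.le
    linarith
  · linarith

/-- For non-parallel edges with a common vertex, Cramer's rule forces the parameter to that vertex.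
In the separated cases the signed area relative to one edge would be a vanishing convex combination
of two numbers of equal sign. -/
theorem EdgesCompatible.exists_common_vertex {α : Type*} {px py : α → ℤ} {a b c d : α}
    (hc : EdgesCompatible px py a b c d) (hne : s(a, b) ≠ s(c, d)) {r s : ℝ}
    (hr0 : 0 ≤ r) (hr1 : r ≤ 1) (hs0 : 0 ≤ s) (hs1 : s ≤ 1)
    (hx : (1 - r) * px a + r * px b = (1 - s) * px c + s * px d)
    (hy : (1 - r) * py a + r * py b = (1 - s) * py c + s * py d) :
    ∃ w, w ∈ s(a, b) ∧ w ∈ s(c, d) ∧ (1 - r) * px a + r * px b = px w ∧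
      (1 - r) * py a + r * py b = py w := by
  rcases hc with ⟨rfl, rfl⟩ | ⟨rfl, rfl⟩ | ⟨hsh, h⟩ | h | h
  · exact absurd rfl hne
  · exact absurd Sym2.eq_swap hne
  · have h' := (Int.cast_ne_zero (α := ℝ)).2 h
    push_cast at h'
    rcases hsh with rfl | rfl | rfl | rfl
    · have : r = 0 := eq_zero_of_mul_eq_mul (s := s) (by linear_combination hx)
        (by linear_combination hy) h'
      exact ⟨a, by simp, by simp, by rw [this]; ring, by rw [this]; ring⟩
    · have : r = 0 := eq_zero_of_mul_eq_mul (s := s - 1) (by linear_combination hx)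
        (by linear_combination hy) h'
      exact ⟨a, by simp, by simp, by rw [this]; ring, by rw [this]; ring⟩
    · have : r - 1 = 0 := eq_zero_of_mul_eq_mul (s := s) (by linear_combination hx)
        (by linear_combination hy) h'
      exact ⟨b, by simp, by simp, by rw [sub_eq_zero.1 this]; ring,
        by rw [sub_eq_zero.1 this]; ring⟩
    · have : r - 1 = 0 := eq_zero_of_mul_eq_mul (s := s - 1) (by linear_combination hx)
        (by linear_combination hy) h'
      exact ⟨b, by simp, by simp, by rw [sub_eq_zero.1 this]; ring,
        by rw [sub_eq_zero.1 this]; ring⟩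
  · have h' := (Int.cast_pos (R := ℝ)).2 h
    push_cast at h'
    refine absurd ?_ (convexCombination_ne_zero hs0 hs1 h')
    linear_combination ((py b : ℝ) - py a) * hx - ((px b : ℝ) - px a) * hy
  · have h' := (Int.cast_pos (R := ℝ)).2 h
    push_cast at h'
    refine absurd ?_ (convexCombination_ne_zero hr0 hr1 h')
    linear_combination ((px d : ℝ) - px c) * hy - ((py d : ℝ) - py c) * hx

theorem Gadget.exists_adj (a : Fin m) : ∃ b, H.adj a b := by
  by_contra! h
  have h1 := H.degree a
  have h2 : ∀ i, H.terminal i = a := by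
    intro i
    by_contra hi
    simp only [h, Fin.sum_univ_three] at h1
    fin_cases i <;> simp_all <;> split_ifs at h1 <;> omega
  exact absurd (H.terminal_injective ((h2 0).trans (h2 1).symm)) (by decide)

end GadgetDrawing

/-! ### Drawing gadgets in small discs around the vertices. -/

namespace StraightDrawing

variable {V : Type} {G : SimpleGraph V} (D : StraightDrawing G)

/-- Discs of radius `ε` around the vertices are disjoint from each other and from the edges which
do not end in their centre. -/
def IsSmall (ε : ℝ) : Prop :=
  0 < ε ∧ (∀ u v, u ≠ v → 2 * ε < ‖D.point u - D.point v‖) ∧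
    ∀ v a b, G.Adj a b → v ∉ s(a, b) →
      ∀ z ∈ segment ℝ (D.point a) (D.point b), ε < ‖z - D.point v‖

theorem exists_isSmall [Finite V] (hG : ∀ v, ∃ w, G.Adj v w) : ∃ ε, D.IsSmall ε := by
  have key : ∀ δ : ℝ, 0 < δ → ∀ᶠ ε in nhdsWithin (0 : ℝ) (Ioi 0), ε < δ := fun δ hδ =>
    nhdsWithin_le_nhds (Iio_mem_nhds hδ)
  have h1 : ∀ᶠ ε in nhdsWithin (0 : ℝ) (Ioi 0), 0 < ε := self_mem_nhdsWithin
  have h2 : ∀ᶠ ε in nhdsWithin (0 : ℝ) (Ioi 0),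
      ∀ u v, u ≠ v → 2 * ε < ‖D.point u - D.point v‖ := by
    simp only [Filter.eventually_all]
    intro u v huv
    have h : 0 < ‖D.point u - D.point v‖ := norm_pos_iff.2 (sub_ne_zero.2 (D.injective.ne huv))
    filter_upwards [key _ (half_pos h)] with ε hε
    linarith
  have h3 : ∀ᶠ ε in nhdsWithin (0 : ℝ) (Ioi 0), ∀ v a b, G.Adj a b → v ∉ s(a, b) →
      ∀ z ∈ segment ℝ (D.point a) (D.point b), ε < ‖z - D.point v‖ := by
    simp only [Filter.eventually_all]
    intro v a b hab hv
    have hclosed : IsClosed (segment ℝ (D.point a) (D.point b)) := by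
      rw [← convexHull_pair]
      exact ((Set.toFinite _).isCompact_convexHull ℝ).isClosed
    have h := (hclosed.notMem_iff_infDist_pos ⟨_, left_mem_segment ℝ _ _⟩).1
      fun h => hv (D.mem_of_point_mem_segment hG hab h)
    filter_upwards [key _ h] with ε hε z hz
    refine hε.trans_le ((Metric.infDist_le_dist_of_mem hz).trans_eq ?_)
    rw [dist_comm, dist_eq_norm]
  exact (h1.and (h2.and h3)).exists

variable (e : ∀ v, Fin 3 ≃ G.neighborSet v)

/-- The unit vector in the direction of an edge. -/
noncomputable def dir (v : V) (i : Fin 3) : ℂ :=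
  ‖D.point (e v i) - D.point v‖⁻¹ • (D.point (e v i) - D.point v)

variable {e}

theorem norm_pos (v : V) (i : Fin 3) : 0 < ‖D.point (e v i) - D.point v‖ :=
  norm_pos_iff.2 (sub_ne_zero.2 (D.injective.ne (G.ne_of_adj (e v i).2).symm))

theorem norm_dir (v : V) (i : Fin 3) : ‖D.dir e v i‖ = 1 := by
  rw [dir, norm_smul, norm_inv, norm_norm, inv_mul_cancel₀ (D.norm_pos v i).ne']

theorem point_eq (v : V) (i : Fin 3) :
    D.point (e v i) = D.point v + ‖D.point (e v i) - D.point v‖ • D.dir e v i := by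
  rw [dir, smul_smul, mul_inv_cancel₀ (D.norm_pos v i).ne', one_smul, add_sub_cancel]

theorem mem_segment_of_le {v : V} {i : Fin 3} {s : ℝ} (h0 : 0 ≤ s)
    (h1 : s ≤ ‖D.point (e v i) - D.point v‖) :
    D.point v + s • D.dir e v i ∈ segment ℝ (D.point v) (D.point (e v i)) := by
  rw [segment_eq_image']
  have h := D.norm_pos (e := e) v i
  refine ⟨s * ‖D.point (e v i) - D.point v‖⁻¹, ⟨by positivity, ?_⟩, ?_⟩
  · rw [← div_eq_mul_inv, div_le_one h]
    exact h1
  · simp only [dir, smul_smul]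

/-- Of two edges leaving `v` in the same direction, the shorter would end on the longer. -/
theorem dir_injective (v : V) : Function.Injective (D.dir e v) := by
  have key : ∀ i j, D.dir e v i = D.dir e v j →
      ‖D.point (e v i) - D.point v‖ ≤ ‖D.point (e v j) - D.point v‖ → i = j := by
    intro i j hij hle
    by_contra hne
    have hmem : D.point (e v i) ∈ segment ℝ (D.point v) (D.point (e v j)) := by
      rw [D.point_eq v i, hij]
      exact D.mem_segment_of_le (norm_nonneg _) hle
    have hv : (e v i : V) ≠ v := (G.ne_of_adj (e v i).2).symm
    have hu : (e v i : V) ≠ e v j := fun h => hne ((e v).injective (Subtype.ext h))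
    have hs : s(v, (e v i : V)) ≠ s(v, (e v j : V)) := fun h => hu (Sym2.congr_right.1 h)
    obtain ⟨w, h1, h2, h3⟩ :=
      D.inter v (e v i) v (e v j) (e v i).2 (e v j).2 hs _ (right_mem_segment ℝ _ _) hmem
    rw [← D.injective h3, Sym2.mem_iff] at h2
    exact h2.elim hv hu
  intro i j hij
  rcases le_total ‖D.point (e v i) - D.point v‖ ‖D.point (e v j) - D.point v‖ with h | h
  · exact key i j hij h
  · exact (key j i hij.symm h).symm

theorem dir_dartRev (v : V) (i : Fin 3) :
    D.dir e (dartRev e (v, i)).1 (dartRev e (v, i)).2 = -D.dir e v i := by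
  obtain ⟨⟨u, j⟩, h⟩ : ∃ q, dartRev e (v, i) = q := ⟨_, rfl⟩
  rw [h]
  obtain ⟨rfl, h2⟩ := dartRev_eq_iff.1 h
  simp only [dir, h2]
  rw [← neg_sub (D.point (e v i)) (D.point v), norm_neg, smul_neg]

/-- The directions at the two ends of an edge are opposite, so the link is that edge of `G`
shortened by `ε` at both ends. -/
theorem exists_of_mem_segment_corner {ε : ℝ} (hε : D.IsSmall ε) {v : V} {i : Fin 3} {z : ℂ}
    (hz : z ∈ segment ℝ (D.point v + ε • D.dir e v i) (D.point (dartRev e (v, i)).1 +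
      ε • D.dir e (dartRev e (v, i)).1 (dartRev e (v, i)).2)) :
    ∃ s, ε ≤ s ∧ s ≤ ‖D.point (e v i) - D.point v‖ - ε ∧ z = D.point v + s • D.dir e v i := by
  have h2 : 2 * ε < ‖D.point (e v i) - D.point v‖ := hε.2.1 _ _ (G.ne_of_adj (e v i).2).symm
  rw [dir_dartRev, show (dartRev e (v, i)).1 = e v i from rfl, D.point_eq v i,
    segment_eq_image] at hz
  obtain ⟨t, ⟨h0, h1⟩, rfl⟩ := hz
  set L := ‖D.point (e v i) - D.point v‖
  refine ⟨(1 - t) * ε + t * (L - ε), by nlinarith, by nlinarith, ?_⟩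
  simp only [Complex.real_smul]
  push_cast
  ring

variable {m : ℕ} (H : Gadget m)

/-- The position of the vertices in the drawing with vertices replaced by small gadgets. -/
noncomputable def replacePoint (e : ∀ v, Fin 3 ≃ G.neighborSet v) (ε : ℝ) (q : V × Fin m) : ℂ :=
  cornerMap (D.point q.1) ε H.size (D.dir e q.1) (H.px q.2) (H.py q.2)

theorem replacePoint_terminal (ε : ℝ) (v : V) (i : Fin 3) :
    D.replacePoint H e ε (v, H.terminal i) = D.point v + ε • D.dir e v i := by
  rw [replacePoint, H.px_terminal, H.py_terminal]
  push_cast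
  exact cornerMap_corner (by exact_mod_cast H.size_pos.ne') i

variable {H} {ε : ℝ}

theorem exists_of_mem_segment_replacePoint {v : V} {a b : Fin m} {z : ℂ}
    (hz : z ∈ segment ℝ (D.replacePoint H e ε (v, a)) (D.replacePoint H e ε (v, b))) :
    ∃ r : ℝ, 0 ≤ r ∧ r ≤ 1 ∧ 0 ≤ (1 - r) * H.px a + r * H.px b ∧
      0 ≤ (1 - r) * H.py a + r * H.py b ∧
      (1 - r) * H.px a + r * H.px b + ((1 - r) * H.py a + r * H.py b) ≤ H.size ∧
      z = cornerMap (D.point v) ε H.size (D.dir e v)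
        ((1 - r) * H.px a + r * H.px b) ((1 - r) * H.py a + r * H.py b) := by
  obtain ⟨r, h0, h1, h⟩ := exists_of_mem_segment_cornerMap hz
  have c1 : ∀ a, (0 : ℝ) ≤ H.px a := fun a => by exact_mod_cast H.px_nonneg a
  have c2 : ∀ a, (0 : ℝ) ≤ H.py a := fun a => by exact_mod_cast H.py_nonneg a
  have c3 : ∀ a, (H.px a + H.py a : ℝ) ≤ H.size := fun a => by exact_mod_cast H.px_add_py_le a
  have h2 := sub_nonneg.2 h1
  refine ⟨r, h0, h1, ?_, ?_, ?_, h⟩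
  · exact add_nonneg (mul_nonneg h2 (c1 a)) (mul_nonneg h0 (c1 b))
  · exact add_nonneg (mul_nonneg h2 (c2 a)) (mul_nonneg h0 (c2 b))
  · have := mul_le_mul_of_nonneg_left (c3 a) h2
    have := mul_le_mul_of_nonneg_left (c3 b) h0
    linarith

theorem norm_sub_le_of_mem_segment (hε : 0 < ε) {v : V} {a b : Fin m} {z : ℂ}
    (hz : z ∈ segment ℝ (D.replacePoint H e ε (v, a)) (D.replacePoint H e ε (v, b))) :
    ‖z - D.point v‖ ≤ ε := by
  obtain ⟨r, -, -, h1, h2, h3, rfl⟩ := D.exists_of_mem_segment_replacePoint hz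
  exact norm_cornerMap_sub_le hε (by exact_mod_cast H.size_pos) (D.norm_dir v) h1 h2 h3

theorem replacePoint_inter_of_fst_eq (hε : 0 < ε) {v : V} {a b c d : Fin m} (hab : H.adj a b)
    (hcd : H.adj c d) (hne : s(a, b) ≠ s(c, d)) {z : ℂ}
    (hz : z ∈ segment ℝ (D.replacePoint H e ε (v, a)) (D.replacePoint H e ε (v, b)))
    (hz' : z ∈ segment ℝ (D.replacePoint H e ε (v, c)) (D.replacePoint H e ε (v, d))) :
    ∃ w, w ∈ s(a, b) ∧ w ∈ s(c, d) ∧ z = D.replacePoint H e ε (v, w) := by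
  obtain ⟨r, r0, r1, -, -, -, rfl⟩ := D.exists_of_mem_segment_replacePoint hz
  obtain ⟨s, s0, s1, -, -, -, h⟩ := D.exists_of_mem_segment_replacePoint hz'
  obtain ⟨hx, hy⟩ := cornerMap_injective hε.ne' (by exact_mod_cast H.size_pos.ne') (D.norm_dir v)
    (D.dir_injective v) h
  obtain ⟨w, h1, h2, h3, h4⟩ := (H.inter a b hab c d hcd).exists_common_vertex hne r0 r1 s0 s1 hx hy
  exact ⟨w, h1, h2, by rw [h3, h4, replacePoint]⟩

theorem replacePoint_injective (hε : D.IsSmall ε) :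
    Function.Injective (D.replacePoint H e ε) := by
  rintro ⟨v, a⟩ ⟨u, b⟩ h
  have hvu : v = u := by
    by_contra hvu
    have h1 := D.norm_sub_le_of_mem_segment hε.1
      (left_mem_segment ℝ (D.replacePoint H e ε (v, a)) (D.replacePoint H e ε (v, a)))
    have h2 := D.norm_sub_le_of_mem_segment hε.1
      (left_mem_segment ℝ (D.replacePoint H e ε (u, b)) (D.replacePoint H e ε (u, b)))
    rw [← h] at h2
    have h3 := hε.2.1 _ _ hvu
    have h4 := norm_sub_le_norm_sub_add_norm_sub (D.point v) (D.replacePoint H e ε (v, a))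
      (D.point u)
    rw [norm_sub_rev] at h1
    linarith
  subst hvu
  obtain ⟨hx, hy⟩ := cornerMap_injective hε.1.ne' (by exact_mod_cast H.size_pos.ne')
    (D.norm_dir v) (D.dir_injective v) h
  rw [H.pos_injective a b (by exact_mod_cast hx) (by exact_mod_cast hy)]

/-- A link starting in the gadget at `v` is disjoint from the gadget except for its terminal. -/
theorem eq_terminal_of_mem_link (hε : D.IsSmall ε) {v : V} {i : Fin 3} {a b : Fin m} {z : ℂ}
    (hab : H.adj a b)
    (hz : z ∈ segment ℝ (D.replacePoint H e ε (v, a)) (D.replacePoint H e ε (v, b)))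
    (hz' : z ∈ segment ℝ (D.replacePoint H e ε (v, H.terminal i))
      (D.replacePoint H e ε (linkEnd e H (v, i)))) :
    H.terminal i ∈ s(a, b) ∧ z = D.replacePoint H e ε (v, H.terminal i) := by
  rw [linkEnd, replacePoint_terminal, replacePoint_terminal] at hz'
  obtain ⟨s, hs, -, hzs⟩ := D.exists_of_mem_segment_corner hε hz'
  have hnorm : ‖z - D.point v‖ = s := by
    rw [hzs, add_sub_cancel_left, norm_smul, norm_dir, mul_one, Real.norm_eq_abs,
      abs_of_pos (hε.1.trans_le hs)]
  have hle := D.norm_sub_le_of_mem_segment hε.1 hz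
  -- The gadget lies in the closed disc of radius `ε` and the link outside the open one.
  have hsε : s = ε := le_antisymm (hnorm ▸ hle) hs
  have hzt : z = D.replacePoint H e ε (v, H.terminal i) := by
    rw [replacePoint_terminal, hzs, hsε]
  refine ⟨?_, hzt⟩
  obtain ⟨b', hb'⟩ := H.exists_adj (H.terminal i)
  by_contra hmem
  have hne : s(a, b) ≠ s(H.terminal i, b') := fun h => hmem (h ▸ Sym2.mem_mk_left _ _)
  obtain ⟨w, h1, -, h3⟩ := D.replacePoint_inter_of_fst_eq hε.1 hab hb' hne hz
    (hzt ▸ left_mem_segment ℝ _ _)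
  rw [hzt] at h3
  have h4 := D.replacePoint_injective hε h3
  exact hmem ((Prod.mk.inj h4).2 ▸ h1)

theorem mem_segment_of_mem_link (hε : D.IsSmall ε) {v : V} {i : Fin 3} {z : ℂ}
    (hz : z ∈ segment ℝ (D.replacePoint H e ε (v, H.terminal i))
      (D.replacePoint H e ε (linkEnd e H (v, i)))) :
    z ∈ segment ℝ (D.point v) (D.point (e v i)) ∧ z ≠ D.point v ∧ z ≠ D.point (e v i) := by
  rw [linkEnd, replacePoint_terminal, replacePoint_terminal] at hz
  obtain ⟨s, h1, h2, rfl⟩ := D.exists_of_mem_segment_corner hε hz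
  have h0 := hε.1
  have hdir : D.dir e v i ≠ 0 := fun h => by simpa [h] using D.norm_dir (e := e) v i
  refine ⟨D.mem_segment_of_le (by linarith) (by linarith), ?_, ?_⟩
  · intro h
    rw [add_eq_left, smul_eq_zero] at h
    exact h.elim (fun h => by linarith) hdir
  · intro h
    rw [D.point_eq v i] at h
    have : s = _ := smul_left_injective ℝ hdir (add_left_cancel h)
    linarith

end StraightDrawing

namespace StraightDrawing

variable {V : Type} {G : SimpleGraph V} (D : StraightDrawing G) {m : ℕ} {H : Gadget m}
  {e : ∀ v, Fin 3 ≃ G.neighborSet v} {ε : ℝ}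

theorem link_symm {v u : V} {i j : Fin 3} (h : dartRev e (v, i) = (u, j)) :
    linkEnd e H (v, i) = (u, H.terminal j) ∧ linkEnd e H (u, j) = (v, H.terminal i) := by
  refine ⟨by rw [linkEnd, h], ?_⟩
  rw [linkEnd, ← h, dartRev_dartRev]

/-- The link starts at `v`, or ends there and can be reversed, or lies on an edge of `G` that misses
the disc around `v`. -/
theorem inter_inner_link (hε : D.IsSmall ε) {v u : V} {i : Fin 3} {a b : Fin m} {z : ℂ}
    (hab : H.adj a b)
    (hz : z ∈ segment ℝ (D.replacePoint H e ε (v, a)) (D.replacePoint H e ε (v, b)))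
    (hz' : z ∈ segment ℝ (D.replacePoint H e ε (u, H.terminal i))
      (D.replacePoint H e ε (linkEnd e H (u, i)))) :
    ∃ w, w ∈ s((v, a), (v, b)) ∧ w ∈ s((u, H.terminal i), linkEnd e H (u, i)) ∧
      z = D.replacePoint H e ε w := by
  have key : ∀ j, z ∈ segment ℝ (D.replacePoint H e ε (v, H.terminal j))
      (D.replacePoint H e ε (linkEnd e H (v, j))) →
      (v, H.terminal j) ∈ s((v, a), (v, b)) ∧ z = D.replacePoint H e ε (v, H.terminal j) := by
    intro j hj
    obtain ⟨h1, h2⟩ := D.eq_terminal_of_mem_link hε hab hz hj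
    refine ⟨?_, h2⟩
    rw [Sym2.mem_iff] at h1 ⊢
    exact h1.imp (congrArg _) (congrArg _)
  by_cases hvu : v = u
  · subst hvu
    obtain ⟨h1, h2⟩ := key i hz'
    exact ⟨_, h1, by simp, h2⟩
  by_cases hvi : v = e u i
  · obtain ⟨j, hj⟩ : ∃ j, dartRev e (u, i) = (v, j) := ⟨_, Prod.ext hvi.symm rfl⟩
    obtain ⟨h1, h2⟩ := link_symm (H := H) hj
    rw [h1] at hz' ⊢
    rw [segment_symm, ← h2] at hz'
    obtain ⟨h3, h4⟩ := key j hz'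
    exact ⟨_, h3, by simp, h4⟩
  · have h1 := (D.mem_segment_of_mem_link hε hz').1
    have h2 := hε.2.2 v u (e u i) (e u i).2 (by simp [hvu, hvi]) z h1
    exact absurd (D.norm_sub_le_of_mem_segment hε.1 hz) (not_le.2 h2)

/-- Different links lie on different edges of `G`; these meet only in vertices of `G`, which links
avoid. -/
theorem inter_link_link (hε : D.IsSmall ε) {v u : V} {i j : Fin 3} {z : ℂ}
    (hne : s((v, H.terminal i), linkEnd e H (v, i)) ≠ s((u, H.terminal j), linkEnd e H (u, j)))
    (hz : z ∈ segment ℝ (D.replacePoint H e ε (v, H.terminal i))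
      (D.replacePoint H e ε (linkEnd e H (v, i))))
    (hz' : z ∈ segment ℝ (D.replacePoint H e ε (u, H.terminal j))
      (D.replacePoint H e ε (linkEnd e H (u, j)))) : False := by
  obtain ⟨h1, h2, h3⟩ := D.mem_segment_of_mem_link hε hz
  obtain ⟨h1', -, -⟩ := D.mem_segment_of_mem_link hε hz'
  by_cases hs : s(v, (e v i : V)) = s(u, (e u j : V))
  · rcases Sym2.eq_iff.1 hs with ⟨rfl, h⟩ | ⟨h, h'⟩
    · exact hne (by rw [(e v).injective (Subtype.ext h)])
    · obtain ⟨h4, h5⟩ := link_symm (H := H) (dartRev_eq_iff.2 ⟨h', h.symm⟩)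
      rw [h4, h5] at hne
      exact hne Sym2.eq_swap
  · obtain ⟨w, hw, -, rfl⟩ := D.inter _ _ _ _ (e v i).2 (e u j).2 hs z h1 h1'
    rcases Sym2.mem_iff.1 hw with rfl | rfl
    · exact h2 rfl
    · exact h3 rfl

/-- The straight-line drawing of the graph with vertices replaced by small gadgets. -/
noncomputable def replaceVertices (hε : D.IsSmall ε) :
    StraightDrawing (replaceVertices e H) where
  point := D.replacePoint H e ε
  injective := D.replacePoint_injective hε
  inter := by
    rintro ⟨v, a⟩ ⟨v', b⟩ ⟨u, c⟩ ⟨u', d⟩ h h' hne z hz hz'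
    rcases h with ⟨h1, h2⟩ | ⟨i, h1, h2⟩ <;> rcases h' with ⟨h1', h2'⟩ | ⟨j, h1', h2'⟩
    · dsimp only at h1 h2 h1' h2'
      subst h1 h1'
      by_cases hvu : v = u
      · subst hvu
        have hne' : s(a, b) ≠ s(c, d) := by
          intro h
          apply hne
          rw [Sym2.eq_iff] at h ⊢
          rcases h with ⟨rfl, rfl⟩ | ⟨rfl, rfl⟩ <;> simp
        obtain ⟨w, h3, h4, h5⟩ := D.replacePoint_inter_of_fst_eq hε.1 h2 h2' hne' hz hz'
        refine ⟨(v, w), ?_, ?_, h5⟩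
        · rw [Sym2.mem_iff] at h3 ⊢
          exact h3.imp (congrArg _) (congrArg _)
        · rw [Sym2.mem_iff] at h4 ⊢
          exact h4.imp (congrArg _) (congrArg _)
      · have h3 := D.norm_sub_le_of_mem_segment hε.1 hz
        have h4 := D.norm_sub_le_of_mem_segment hε.1 hz'
        have h5 := hε.2.1 _ _ hvu
        have h6 := norm_sub_le_norm_sub_add_norm_sub (D.point v) z (D.point u)
        rw [norm_sub_rev] at h3
        linarith
    · dsimp only at h1 h2 h1' h2'
      subst h1 h1'
      rw [h2'] at hz' ⊢
      exact D.inter_inner_link hε h2 hz hz'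
    · dsimp only at h1 h2 h1' h2'
      subst h1 h1'
      rw [h2] at hz ⊢
      obtain ⟨w, h3, h4, h5⟩ := D.inter_inner_link hε h2' hz' hz
      exact ⟨w, h4, h3, h5⟩
    · dsimp only at h1 h2 h1' h2'
      subst h1 h1'
      rw [h2] at hz hne
      rw [h2'] at hz' hne
      exact (D.inter_link_link hε hne hz hz').elim

end StraightDrawing

theorem nonempty_straightDrawing_replaceVertices {V : Type} [Finite V] {G : SimpleGraph V}
    (D : StraightDrawing G) (e : ∀ v, Fin 3 ≃ G.neighborSet v) {m : ℕ} (H : Gadget m) :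
    Nonempty (StraightDrawing (replaceVertices e H)) := by
  obtain ⟨ε, hε⟩ := D.exists_isSmall fun v => ⟨e v 0, (e v 0).2⟩
  exact ⟨D.replaceVertices hε⟩

/-! ### Arbitrarily large drawn cubic graphs, and the sources of gaps. -/

/-- A straight-line drawing of the complete graph on four vertices. -/
noncomputable def straightDrawingTop : StraightDrawing (⊤ : SimpleGraph (Fin 4)) where
  point v := ⟨(![0, 3, 0, 1] v : ℤ), (![0, 0, 3, 1] v : ℤ)⟩
  injective := by
    intro a b h
    rw [Complex.mk.injEq, Int.cast_inj, Int.cast_inj] at h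
    revert a b
    decide
  inter := by
    have hc : ∀ a b : Fin 4, a ≠ b → ∀ c d, c ≠ d →
        EdgesCompatible ![0, 3, 0, 1] ![0, 0, 3, 1] a b c d := by decide
    intro a b c d hab hcd hne z hz hz'
    rw [segment_eq_image] at hz hz'
    obtain ⟨r, ⟨r0, r1⟩, rfl⟩ := hz
    obtain ⟨s, ⟨s0, s1⟩, h⟩ := hz'
    have hre := congrArg Complex.re h
    have him := congrArg Complex.im h
    simp only [Complex.add_re, Complex.add_im, Complex.real_smul, Complex.re_ofReal_mul,
      Complex.im_ofReal_mul] at hre him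
    obtain ⟨w, h1, h2, h3, h4⟩ := (hc a b hab c d hcd).exists_common_vertex hne r0 r1 s0 s1
      hre.symm him.symm
    refine ⟨w, h1, h2, Complex.ext ?_ ?_⟩
    · simpa only [Complex.add_re, Complex.real_smul, Complex.re_ofReal_mul] using h3
    · simpa only [Complex.add_im, Complex.real_smul, Complex.im_ofReal_mul] using h4

theorem isCubicGraph_top : IsCubicGraph (⊤ : SimpleGraph (Fin 4)) := by
  refine ⟨SimpleGraph.connected_top, fun v => ?_⟩
  rw [SimpleGraph.neighborSet_top, Set.ncard_compl, Set.ncard_singleton, Nat.card_fin]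

theorem le_card_prod_fin {V : Type} [Fintype V] {m : ℕ} (H : Gadget m) :
    Fintype.card V ≤ Fintype.card (V × Fin m) := by
  rw [Fintype.card_prod, Fintype.card_fin]
  exact Nat.le_mul_of_pos_right _ (H.terminal 0).pos

theorem exists_large_cubic_straightDrawing (N : ℕ) :
    ∃ (V : Type) (_ : Fintype V) (G : SimpleGraph V), N ≤ Fintype.card V ∧
      IsCubicGraph G ∧ Nonempty (StraightDrawing G) := by
  induction N with
  | zero => exact ⟨_, _, _, Nat.zero_le _, isCubicGraph_top, ⟨straightDrawingTop⟩⟩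
  | succ N ih =>
    obtain ⟨V, _, G, hN, hG, ⟨D⟩⟩ := ih
    obtain ⟨e⟩ := hG.exists_enumeration
    refine ⟨V × Fin 3, inferInstance, replaceVertices e triangleGadget, ?_,
      isCubicGraph_replaceVertices e _ hG.1, nonempty_straightDrawing_replaceVertices D e _⟩
    have := hG.1.nonempty
    have := Fintype.card_pos (α := V)
    rw [Fintype.card_prod, Fintype.card_fin]
    omega

theorem hasGapAt_of_three_lt {ξ : ℝ} (hξ : 3 < |ξ|) : HasGapAt ξ := by
  refine ⟨|ξ| - 3, sub_pos.2 hξ, fun N => ?_⟩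
  obtain ⟨V, _, G, hN, hG, hD⟩ := exists_large_cubic_straightDrawing N
  refine ⟨V, _, G, hN, hG, hD, fun c hc => hG.notEigenvalue ?_⟩
  have := abs_sub_abs_le_abs_sub ξ c
  rw [abs_sub_comm] at hc
  linarith

theorem Gadget.IsContracting.hasGapAt {m : ℕ} {H : Gadget m} {ξ : ℝ} (h : H.IsContracting ξ) :
    HasGapAt ξ := by
  obtain ⟨ε, hε, hc⟩ := h.eventually
  refine ⟨ε, hε, fun N => ?_⟩
  obtain ⟨V, _, G, hN, hG, ⟨D⟩⟩ := exists_large_cubic_straightDrawing N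
  obtain ⟨e⟩ := hG.exists_enumeration
  exact ⟨V × Fin m, inferInstance, replaceVertices e H, hN.trans (le_card_prod_fin H),
    isCubicGraph_replaceVertices e _ hG.1, nonempty_straightDrawing_replaceVertices D e _,
    fun c hcξ => (hc c hcξ).notEigenvalue e⟩

theorem HasGapAt.of_triangleGadget {ξ : ℝ} (h0 : ξ ≠ 0) (h2 : ξ ≠ -2)
    (h : HasGapAt (ξ ^ 2 - ξ - 3)) : HasGapAt ξ := by
  obtain ⟨ε, hε, h⟩ := h
  have hev : ∀ᶠ c in nhds ξ, c ≠ 0 ∧ c ≠ -2 ∧ |c ^ 2 - c - 3 - (ξ ^ 2 - ξ - 3)| < ε := by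
    have hcont : Continuous fun c : ℝ => c ^ 2 - c - 3 := by fun_prop
    exact (isOpen_ne.eventually_mem h0).and ((isOpen_ne.eventually_mem h2).and
      ((hcont.tendsto ξ).eventually (Metric.ball_mem_nhds _ hε)))
  obtain ⟨δ, hδ, hball⟩ := Metric.eventually_nhds_iff.1 hev
  refine ⟨δ, hδ, fun N => ?_⟩
  obtain ⟨V, _, G, hN, hG, ⟨D⟩, hc⟩ := h N
  obtain ⟨e⟩ := hG.exists_enumeration
  refine ⟨V × Fin 3, inferInstance, replaceVertices e triangleGadget,
    hN.trans (le_card_prod_fin triangleGadget),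
    isCubicGraph_replaceVertices e _ hG.1, nonempty_straightDrawing_replaceVertices D e _,
    fun c hcξ => ?_⟩
  obtain ⟨hc0, hc2, hcε⟩ := hball (by rwa [Real.dist_eq])
  exact (hc _ hcε).replaceVertices_triangleGadget e hc0 hc2

/-! ### Three contracting gadgets. -/

/-- The adjacency relation of the graph with a given list of edges. -/
def listAdj {m : ℕ} (L : List (Fin m × Fin m)) (a b : Fin m) : Bool :=
  decide ((a, b) ∈ L ∨ (b, a) ∈ L)

/-- The cube without a vertex, whose neighbours are the terminals. -/
def cubeGadget : Gadget 7 where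
  adj := listAdj [(0, 1), (0, 2), (0, 3), (1, 5), (1, 6), (2, 4), (2, 6), (3, 4), (3, 5)]
  symm := by decide
  loopless := by decide
  terminal := ![4, 5, 6]
  terminal_injective := by decide
  degree := by decide
  descends := by decide
  size := 24
  size_pos := by decide
  px := ![8, 9, 6, 9, 0, 24, 0]
  py := ![8, 9, 9, 6, 0, 0, 24]
  px_terminal := by decide
  py_terminal := by decide
  px_nonneg := by decide
  py_nonneg := by decide
  px_add_py_le := by decide
  pos_injective := by decide
  inter := by decide

/-- A vertex joined to both ends of a chain which contains a diamond. -/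
def diamondGadget : Gadget 7 where
  adj := listAdj [(0, 1), (0, 2), (1, 3), (2, 4), (3, 5), (3, 6), (4, 5), (4, 6), (5, 6)]
  symm := by decide
  loopless := by decide
  terminal := ![1, 2, 0]
  terminal_injective := by decide
  degree := by decide
  descends := by decide
  size := 24
  size_pos := by decide
  px := ![0, 0, 24, 6, 17, 11, 11]
  py := ![24, 0, 0, 1, 1, 4, 2]
  px_terminal := by decide
  py_terminal := by decide
  px_nonneg := by decide
  py_nonneg := by decide
  px_add_py_le := by decide
  pos_injective := by decide
  inter := by decide

set_option maxRecDepth 4000 in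
/-- A vertex joined to both ends of a chain which contains two triangles. -/
def ladderGadget : Gadget 9 where
  adj := listAdj [(0, 1), (0, 2), (1, 3), (2, 4), (3, 5), (3, 6), (5, 6), (5, 7), (6, 8), (7, 8),
    (4, 7), (4, 8)]
  symm := by decide
  loopless := by decide
  terminal := ![1, 2, 0]
  terminal_injective := by decide
  degree := by decide
  descends := by decide
  size := 24
  size_pos := by decide
  px := ![0, 0, 24, 4, 19, 8, 8, 14, 14]
  py := ![24, 0, 0, 2, 2, 5, 3, 5, 3]
  px_terminal := by decide
  py_terminal := by decide
  px_nonneg := by decide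
  py_nonneg := by decide
  px_add_py_le := by decide
  pos_injective := by decide
  inter := by decide

theorem eq_zero_of_mul_add_mul_nonpos {a b k l : ℝ} (ha : 0 ≤ a) (hb : 0 ≤ b) (hk : 0 < k)
    (hl : 0 < l) (h : a * k + b * l ≤ 0) : a = 0 ∧ b = 0 := by
  have h1 := mul_nonneg ha hk.le
  have h2 := mul_nonneg hb hl.le
  exact ⟨(mul_eq_zero.1 (show a * k = 0 by linarith)).resolve_right hk.ne',
    (mul_eq_zero.1 (show b * l = 0 by linarith)).resolve_right hl.ne'⟩

theorem three_mul_sum_sq (a b c : ℝ) : 3 * (a ^ 2 + b ^ 2 + c ^ 2) =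
    (a + b + c) ^ 2 + (a - b) ^ 2 + (a - c) ^ 2 + (b - c) ^ 2 := by
  ring

/-- The threefold symmetry splits the terminal and outer values into their sum and their
differences, and `three_mul_sum_sq` splits the square sums accordingly. On each part the outer
values are a multiple of the terminal values; `k1` and `k2` say that the outer part is larger. -/
theorem isContracting_cubeGadget {c : ℝ} (h1 : -2 ≤ c) (h2 : c ≤ -17 / 10) :
    cubeGadget.IsContracting c := by
  intro x hx hne
  have e0 := hx 0 (by decide)
  have e1 := hx 1 (by decide)
  have e2 := hx 2 (by decide)
  have e3 := hx 3 (by decide)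
  simp only [Gadget.innerSum, cubeGadget, listAdj, Fin.sum_univ_seven] at e0 e1 e2 e3 ⊢
  simp [Fin.sum_univ_three] at e0 e1 e2 e3 ⊢
  by_contra! hle
  apply hne
  have hu : 289 / 100 ≤ c ^ 2 := by nlinarith
  have hu' : c ^ 2 ≤ 4 := by nlinarith
  have k1 : 0 < c ^ 2 * (c ^ 2 - 7) ^ 2 - (c ^ 2 - 3) ^ 2 := by nlinarith [sq_nonneg (c ^ 2 - 7)]
  have k2 : 0 < (c ^ 2 - 1) ^ 2 - c ^ 2 := by nlinarith
  have d1 : x 4 - x 5 = -c * (x 1 - x 2) := by linear_combination e2 - e1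
  have d2 : x 4 - x 6 = -c * (x 1 - x 3) := by linear_combination e3 - e1
  have d3 : x 5 - x 6 = -c * (x 2 - x 3) := by linear_combination e3 - e2
  have ht : x 4 + x 5 + x 6 = (c ^ 2 - 3) / 2 * x 0 := by
    linear_combination (e1 + e2 + e3 + c * e0) / 2
  have hyt := three_mul_sum_sq (c * x 4 - (x 2 + x 3)) (c * x 5 - (x 1 + x 3))
    (c * x 6 - (x 1 + x 2))
  rw [show c * x 4 - (x 2 + x 3) + (c * x 5 - (x 1 + x 3)) + (c * x 6 - (x 1 + x 2)) =
      c * (c ^ 2 - 7) / 2 * x 0 by linear_combination c * ht - 2 * e0,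
    show c * x 4 - (x 2 + x 3) - (c * x 5 - (x 1 + x 3)) = (1 - c ^ 2) * (x 1 - x 2) by
      linear_combination c * d1,
    show c * x 4 - (x 2 + x 3) - (c * x 6 - (x 1 + x 2)) = (1 - c ^ 2) * (x 1 - x 3) by
      linear_combination c * d2,
    show c * x 5 - (x 1 + x 3) - (c * x 6 - (x 1 + x 2)) = (1 - c ^ 2) * (x 2 - x 3) by
      linear_combination c * d3] at hyt
  have htt := three_mul_sum_sq (x 4) (x 5) (x 6)
  rw [ht, d1, d2, d3] at htt
  obtain ⟨h3, h4⟩ := eq_zero_of_mul_add_mul_nonpos (a := x 0 ^ 2 / 4)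
    (b := (x 1 - x 2) ^ 2 + (x 1 - x 3) ^ 2 + (x 2 - x 3) ^ 2) (by positivity) (by positivity)
    k1 k2 (by linarith)
  have z0 : x 0 = 0 := by simpa using h3
  have z12 : x 1 - x 2 = 0 := 
    (sq_nonpos_iff _).1 (by linarith [sq_nonneg (x 1 - x 3), sq_nonneg (x 2 - x 3)])
  have z13 : x 1 - x 3 = 0 := 
    (sq_nonpos_iff _).1 (by linarith [sq_nonneg (x 1 - x 2), sq_nonneg (x 2 - x 3)])
  rw [z12] at d1
  rw [z13] at d2
  rw [z0] at e0 ht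
  funext a
  fin_cases a <;> simp <;> linarith

/-- The inner equations leave `x 0`, `x 3`, `x 5` free; the difference of the square sums is the
positive definite form in `key`. -/
theorem isContracting_diamondGadget : diamondGadget.IsContracting 0 := by
  intro x hx hne
  have e3 := hx 3 (by decide)
  have e4 := hx 4 (by decide)
  have e5 := hx 5 (by decide)
  have e6 := hx 6 (by decide)
  simp only [Gadget.innerSum, diamondGadget, listAdj, Fin.sum_univ_seven] at e3 e4 e5 e6 ⊢
  simp [Fin.sum_univ_three] at e3 e4 e5 e6 ⊢
  by_contra! hle
  apply hne
  have h1 : x 1 = -2 * x 5 := by linarith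
  have h2 : x 2 = -2 * x 5 := by linarith
  have h4 : x 4 = -x 3 - x 5 := by linarith
  have h6 : x 6 = x 5 := by linarith
  rw [h1, h2, h4] at hle
  have key : (x 0 - x 5) ^ 2 + x 3 ^ 2 + (x 3 + x 5) ^ 2 + 7 * x 5 ^ 2 ≤ 0 := by linarith
  have s1 := sq_nonneg (x 0 - x 5)
  have s2 := sq_nonneg (x 3)
  have s3 := sq_nonneg (x 3 + x 5)
  have s4 := sq_nonneg (x 5)
  have z3 : x 3 = 0 := (sq_nonpos_iff _).1 (by linarith)
  have z5 : x 5 = 0 := (sq_nonpos_iff _).1 (by linarith)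
  have z0 : x 0 - x 5 = 0 := (sq_nonpos_iff _).1 (by linarith)
  funext a
  fin_cases a <;> simp <;> linarith

/-- Here `x 0`, `x 5`, `x 7` remain free, and `key` is again positive definite. -/
theorem isContracting_ladderGadget : ladderGadget.IsContracting (-1) := by
  intro x hx hne
  have e3 := hx 3 (by decide)
  have e4 := hx 4 (by decide)
  have e5 := hx 5 (by decide)
  have e6 := hx 6 (by decide)
  have e7 := hx 7 (by decide)
  have e8 := hx 8 (by decide)
  simp only [Gadget.innerSum, ladderGadget, listAdj, Fin.sum_univ_succ] at e3 e4 e5 e6 e7 e8 ⊢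
  simp at e3 e4 e5 e6 e7 e8 ⊢
  by_contra! hle
  apply hne
  have h6 : x 6 = x 5 := by linarith
  have h8 : x 8 = x 7 := by linarith
  have h3 : x 3 = -2 * x 5 - x 7 := by linarith
  have h4 : x 4 = -2 * x 7 - x 5 := by linarith
  have h1 : x 1 = x 7 := by linarith
  have h2 : x 2 = x 5 := by linarith
  rw [h1, h2, h3, h4] at hle
  have key : (x 0 - x 5) ^ 2 + (x 0 - x 7) ^ 2 + (x 5 + x 7) ^ 2 + 2 * x 5 ^ 2 +
      2 * x 7 ^ 2 ≤ 0 := by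
    linarith
  have s1 := sq_nonneg (x 0 - x 5)
  have s2 := sq_nonneg (x 0 - x 7)
  have s3 := sq_nonneg (x 5 + x 7)
  have s4 := sq_nonneg (x 5)
  have s5 := sq_nonneg (x 7)
  have z5 : x 5 = 0 := (sq_nonpos_iff _).1 (by linarith)
  have z7 : x 7 = 0 := (sq_nonpos_iff _).1 (by linarith)
  have z0 : x 0 - x 5 = 0 := (sq_nonpos_iff _).1 (by linarith)
  funext a
  fin_cases a <;> simp <;> linarith

/-! ### The dynamics of `ξ ↦ ξ ^ 2 - ξ - 3` on `[-3, 3)`. -/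

theorem hasGapAt {ξ : ℝ} (h1 : -3 ≤ ξ) (h2 : ξ < 3) : HasGapAt ξ := by
  have hzero : HasGapAt 0 := isContracting_diamondGadget.hasGapAt
  have hneg : ∀ ξ : ℝ, -3 ≤ ξ → ξ < -2 → HasGapAt ξ := fun ξ h1 h2 =>
    .of_triangleGadget (by linarith) (by linarith)
      (hasGapAt_of_three_lt (lt_abs.2 (Or.inl (by nlinarith))))
  have hunit : ∀ ξ : ℝ, 0 < ξ → ξ ≤ 1 → HasGapAt ξ := by
    intro ξ h1 h2
    refine .of_triangleGadget (by linarith) (by linarith) ?_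
    rcases h2.lt_or_eq with h2 | rfl
    · exact hasGapAt_of_three_lt (lt_abs.2 (Or.inr (by nlinarith)))
    · exact hneg _ (by norm_num) (by norm_num)
  have hcube : ∀ ξ : ℝ, -2 ≤ ξ → ξ ≤ -17 / 10 → HasGapAt ξ := fun ξ h1 h2 =>
    (isContracting_cubeGadget h1 h2).hasGapAt
  have htwo : ∀ ξ : ℝ, -3 ≤ ξ → ξ ≤ -17 / 10 → HasGapAt ξ := fun ξ h1 h2 =>
    (lt_or_ge ξ (-2)).elim (hneg ξ h1) fun h => hcube ξ h h2
  -- The bound `8 / 5` lies just above `1.59`, the image of `-17 / 10`; its own image `-2.04` is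
  -- within reach of `htwo`.
  have hone : ∀ ξ : ℝ, 1 < ξ → ξ ≤ 8 / 5 → HasGapAt ξ := fun ξ h1 h2 =>
    .of_triangleGadget (by linarith) (by linarith) (htwo _ (by nlinarith) (by nlinarith))
  -- The distance to the fixed point `-1` is multiplied by `|ξ - 2| > 2`, so after at most `n` steps
  -- the orbit has left `(-2, 0)` or met `hcube`.
  have hmid : ∀ n : ℕ, ∀ ξ : ℝ, -2 < ξ → ξ < 0 → 1 ≤ 2 ^ n * |ξ + 1| → HasGapAt ξ := by
    intro n
    induction n with
    | zero =>
      intro ξ h1 h2 h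
      rw [pow_zero, one_mul, le_abs] at h
      rcases h with h | h <;> linarith
    | succ n ih =>
      intro ξ h1 h2 h
      rcases le_or_gt ξ (-17 / 10) with h3 | h3
      · exact hcube ξ h1.le h3
      refine .of_triangleGadget h2.ne h1.ne' ?_
      rcases le_or_gt (ξ ^ 2 - ξ - 3) (-2) with h4 | h4
      · exact htwo _ (by nlinarith) (by linarith)
      rcases lt_trichotomy (ξ ^ 2 - ξ - 3) 0 with h5 | h5 | h5
      · refine ih _ h4 h5 (h.trans ?_)
        rw [show ξ ^ 2 - ξ - 3 + 1 = (ξ + 1) * (ξ - 2) by ring, abs_mul, pow_succ, mul_assoc]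
        refine mul_le_mul_of_nonneg_left ?_ (by positivity)
        rw [mul_comm]
        refine mul_le_mul_of_nonneg_left ?_ (abs_nonneg _)
        rw [abs_of_neg (by linarith)]
        linarith
      · rwa [h5]
      rcases le_or_gt (ξ ^ 2 - ξ - 3) 1 with h6 | h6
      · exact hunit _ h5 h6
      · exact hone _ h6 (by nlinarith)
  have hnonpos : ∀ ξ : ℝ, -3 ≤ ξ → ξ ≤ 1 → HasGapAt ξ := by
    intro ξ h1 h2
    rcases le_or_gt ξ (-2) with h3 | h3
    · exact htwo ξ h1 (by linarith)
    rcases lt_trichotomy ξ 0 with h4 | rfl | h4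
    · by_cases h5 : ξ = -1
      · rw [h5]
        exact isContracting_ladderGadget.hasGapAt
      · have h6 : 0 < |ξ + 1| := abs_pos.2 fun h => h5 (by linarith)
        obtain ⟨n, hn⟩ := pow_unbounded_of_one_lt |ξ + 1|⁻¹ one_lt_two
        refine hmid n ξ h3 h4 ?_
        exact (inv_mul_cancel₀ h6.ne').symm.trans_le (mul_le_mul_of_nonneg_right hn.le h6.le)
    · exact hzero
    · exact hunit ξ h4 h2
  -- For `ξ > 1` the distance to the fixed point `3` is multiplied by `ξ + 2 > 3`, so the orbit
  -- eventually drops to `1` or below.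
  have hbig : ∀ n : ℕ, ∀ ξ : ℝ, -3 ≤ ξ → ξ < 3 → 2 ≤ 3 ^ n * (3 - ξ) → HasGapAt ξ := by
    intro n
    induction n with
    | zero => exact fun ξ h1 h2 h => hnonpos ξ h1 (by linarith)
    | succ n ih =>
      intro ξ h1 h2 h
      rcases le_or_gt ξ 1 with h3 | h3
      · exact hnonpos ξ h1 h3
      refine .of_triangleGadget (by linarith) (by linarith) (ih _ (by nlinarith) (by nlinarith) ?_)
      refine h.trans ?_
      rw [show 3 - (ξ ^ 2 - ξ - 3) = (ξ + 2) * (3 - ξ) by ring, pow_succ, mul_assoc]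
      refine mul_le_mul_of_nonneg_left ?_ (by positivity)
      exact mul_le_mul_of_nonneg_right (by linarith) (by linarith)
  obtain ⟨n, hn⟩ := pow_unbounded_of_one_lt (2 / (3 - ξ)) (show (1 : ℝ) < 3 by norm_num)
  refine hbig n ξ h1 h2 ?_
  rw [← div_le_iff₀ (by linarith)]
  exact hn.le

theorem theorem1 (ξ : ℝ) (hξ : ξ ∈ Set.Ico (-3 : ℝ) 3) : IsPlanarGapped ξ :=
  (hasGapAt hξ.1 hξ.2).isPlanarGapped
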